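/- Let $(R,\mathfrak m_R)$ be a (non-zero, commutative) Noetherian local ring and let $I$ be a proper ideal of $R$. Let $R\bowtie I=\{(r,r+i)\mid r\in R,\ i\in I\}\subseteq R\times R$ be the amalgamated duplication of $R$ along $I$; it is a local ring, and $\mathfrak m$ denotes its maximal ideal. Let $\mathfrak mR$ and $\mathfrak m(R/I)$ be the extensions of $\mathfrak m$ along the projection $R\bowtie I\to R$, $(r,r+i)\mapsto r$, and along the composite $R\bowtie I\to R\to R/I$. For an ideal $\mathfrak a$ of a ring $A$ and an $A$-module $M$, let $\operatorname{grade}(\mathfrak a,M)$ be the supremum of the lengths of the $M$-regular sequences contained in $\mathfrak a$, and let $\Gamma_{\mathfrak a}(M)=\{x\in M\mid \mathfrak a^t x=0\text{ for some }t\in\mathbb N\}$; the depth of a local ring $A$ with maximal ideal $\mathfrak m_A$ is $\operatorname{depth}(A)=\operatorname{grade}(\mathfrak m_A,A)$. (i) If $n\ge 0$ is an integer such that $\operatorname{grade}(\mathfrak mR,R)>\operatorname{grade}(\mathfrak m(R/I),R/I)=n$, then $\operatorname{depth}(R\bowtie I)=n+1$. (ii) If $\dim(R/I)=0$ and $\Gamma_{\mathfrak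 mR}(R)\subseteq I$, then $\operatorname{depth}(R\bowtie I)=\min\{\operatorname{grade}(\mathfrak mR,R),1\}\le 1$. -/

import Mathlib

namespace AmalgamatedDuplication

/-- The grade of an ideal `a` on a module `M`: the length of the longest `M`-regular sequence
contained in `a`, formed as a supremum in `ℕ∞`. -/
noncomputable def grade {A : Type*} [CommRing A] (a : Ideal A)
    (M : Type*) [AddCommGroup M] [Module A M] : ℕ∞ :=
  ⨆ (rs : List A) (_ : RingTheory.Sequence.IsRegular M rs) (_ : ∀ r ∈ rs, r ∈ a),
    (rs.length : ℕ∞)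

/-- The depth of a local ring: the grade of its maximal ideal on the ring itself. -/
noncomputable def depth (A : Type*) [CommRing A] [IsLocalRing A] : ℕ∞ :=
  grade (IsLocalRing.maximalIdeal A) A

/-- The `a`-torsion submodule `Γ_a(M) = {x ∈ M | a ^ t x = 0 for some t}`. -/
def idealTorsion {A : Type*} [CommRing A] (a : Ideal A)
    (M : Type*) [AddCommGroup M] [Module A M] : Submodule A M where
  carrier := {x | ∃ t : ℕ, ∀ y ∈ a ^ t, y • x = 0}
  zero_mem' := ⟨0, fun y _ => smul_zero y⟩
  add_mem' := by
    rintro x z ⟨s, hs⟩ ⟨t, ht⟩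
    refine ⟨s + t, fun y hy => ?_⟩
    rw [smul_add, hs y (Ideal.pow_le_pow_right (Nat.le_add_right s t) hy),
      ht y (Ideal.pow_le_pow_right (Nat.le_add_left t s) hy), add_zero]
  smul_mem' := by
    rintro c x ⟨t, ht⟩
    exact ⟨t, fun y hy => by rw [smul_comm, ht y hy, smul_zero]⟩

/-- The amalgamated duplication `R ⋈ I = {(r, r + i) | r ∈ R, i ∈ I}`, a subring of `R × R`. -/
def duplication {R : Type*} [CommRing R] (I : Ideal R) : Subring (R × R) where
  carrier := {p | ∃ r : R, ∃ i ∈ I, p = (r, r + i)}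
  zero_mem' := ⟨0, 0, I.zero_mem, by ext <;> simp⟩
  one_mem' := ⟨1, 0, I.zero_mem, by ext <;> simp⟩
  add_mem' := by
    rintro _ _ ⟨r, i, hi, rfl⟩ ⟨s, j, hj, rfl⟩
    exact ⟨r + s, i + j, I.add_mem hi hj, Prod.ext rfl (by simp only [Prod.mk_add_mk]; ring)⟩
  mul_mem' := by
    rintro _ _ ⟨r, i, hi, rfl⟩ ⟨s, j, hj, rfl⟩
    exact ⟨r * s, r * j + i * (s + j),
      I.add_mem (I.mul_mem_left r hj) (I.mul_mem_right (s + j) hi),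
      Prod.ext rfl (by simp only [Prod.mk_mul_mk]; ring)⟩
  neg_mem' := by
    rintro _ ⟨r, i, hi, rfl⟩
    exact ⟨-r, -i, I.neg_mem hi, Prod.ext rfl (by simp only [Prod.neg_mk]; ring)⟩

/-- The projection `R ⋈ I → R`, `(r, r + i) ↦ r`. -/
def toBase {R : Type*} [CommRing R] (I : Ideal R) : duplication I →+* R :=
  (RingHom.fst R R).comp (duplication I).subtype

/-- The composite `R ⋈ I → R → R ⧸ I`. -/
def toQuotient {R : Type*} [CommRing R] (I : Ideal R) : duplication I →+* R ⧸ I :=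
  (Ideal.Quotient.mk I).comp (toBase I)

theorem isUnit_of_isUnit_toBase {R : Type*} [CommRing R] [IsLocalRing R] {I : Ideal R}
    (hI : I ≠ ⊤) (x : duplication I) (hx : IsUnit (toBase I x)) : IsUnit x := by
  obtain ⟨_, r, i, hi, rfl⟩ := x
  have hr : IsUnit r := hx
  have hs : IsUnit (r + i) := by
    by_contra h
    have h1 : r + i ∈ IsLocalRing.maximalIdeal R := h
    have h2 : r ∈ IsLocalRing.maximalIdeal R := by
      simpa using Ideal.sub_mem _ h1 (IsLocalRing.le_maximalIdeal hI hi)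
    exact h2 hr
  obtain ⟨u, hu⟩ := hr.exists_right_inv
  obtain ⟨v, hv⟩ := hs.exists_right_inv
  have hmem : ((u, v) : R × R) ∈ duplication I := by
    refine ⟨u, -(u * v * i), I.neg_mem (I.mul_mem_left _ hi), Prod.ext rfl ?_⟩
    change v = u + -(u * v * i)
    linear_combination (-v) * hu + u * hv
  refine IsUnit.of_mul_eq_one ⟨(u, v), hmem⟩ (Subtype.ext (Prod.ext hu hv))

/-- For a proper ideal `I` of a local ring `R`, the ring `R ⋈ I` is local. -/
theorem isLocalRing_duplication {R : Type*} [CommRing R] [IsLocalRing R] {I : Ideal R}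
    (hI : I ≠ ⊤) : IsLocalRing (duplication I) := by
  have : IsLocalHom (toBase I) := ⟨isUnit_of_isUnit_toBase hI⟩
  exact RingHom.domain_isLocalRing (toBase I)

/-- The extension `𝔪R` to `R` of the maximal ideal `𝔪` of `R ⋈ I`, for a proper ideal `I`. -/
noncomputable def extBase {R : Type*} [CommRing R] [IsLocalRing R] {I : Ideal R}
    (hI : I ≠ ⊤) : Ideal R :=
  haveI := isLocalRing_duplication hI
  (IsLocalRing.maximalIdeal (duplication I)).map (toBase I)

/-- The extension `𝔪(R ⧸ I)` to `R ⧸ I` of the maximal ideal `𝔪` of `R ⋈ I`. -/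
noncomputable def extQuotient {R : Type*} [CommRing R] [IsLocalRing R] {I : Ideal R}
    (hI : I ≠ ⊤) : Ideal (R ⧸ I) :=
  haveI := isLocalRing_duplication hI
  (IsLocalRing.maximalIdeal (duplication I)).map (toQuotient I)

end AmalgamatedDuplication

namespace AmalgamatedDuplication

open RingTheory.Sequence IsLocalRing CategoryTheory Abelian

universe u

section Grade

/-! The `R ⋈ I`-linear map `(a, b) ↦ b - a` gives an exact sequence `0 → R ⋈ I → R × R → R ⧸ I → 0`.
Grades over a Noetherian local ring are read off from the vanishing of `Ext` out of the residue
field, so if `R ⧸ I` has grade `n` and `R × R` has larger grade, the long exact sequence forces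
depth `n + 1` on `R ⋈ I`. The grade of `R ⧸ I` is unchanged along the surjection from `R ⋈ I`, and
that of `R × R` is bounded below through the diagonal `R → R ⋈ I`. For (ii), `R ⧸ I` is Artinian,
hence of grade `0`. If `𝔪R` has positive grade, (i) applies with `n = 0`; otherwise a socle element
of `R`, embedded diagonally, shows that `R ⋈ I` has depth `0`. -/

theorem isRegular_take {A M : Type*} [CommRing A] [AddCommGroup M] [Module A M]
    {rs : List A} (h : IsRegular M rs) (n : ℕ) : IsRegular M (rs.take n) := by
  have h1 := h.toIsWeaklyRegular
  rw [← List.take_append_drop n rs, isWeaklyRegular_append_iff] at h1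
  refine ⟨h1.1, fun h2 => h.top_ne_smul (le_antisymm ?_ le_top)⟩
  conv_lhs => rw [h2]
  exact Submodule.smul_mono_left (Ideal.span_mono fun x hx => List.mem_of_mem_take hx)

theorem natCast_le_grade_iff {A M : Type*} [CommRing A] [AddCommGroup M] [Module A M]
    [Nontrivial M] (a : Ideal A) (n : ℕ) :
    (n : ℕ∞) ≤ grade a M ↔
      ∃ rs : List A, rs.length = n ∧ (∀ r ∈ rs, r ∈ a) ∧ IsRegular M rs := by
  constructor
  · intro h
    -- A supremum in `ℕ∞` need not be attained; a strict bound by the predecessor yields an actual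
    -- sequence, which is then truncated.
    obtain _ | n := n
    · exact ⟨[], rfl, by simp, .nil A M⟩
    have h1 : (n : ℕ∞) < grade a M := lt_of_lt_of_le (by exact_mod_cast n.lt_succ_self) h
    simp only [grade, lt_iSup_iff] at h1
    obtain ⟨rs, hreg, hmem, hlen⟩ := h1
    have hlen : n < rs.length := by exact_mod_cast hlen
    exact ⟨rs.take (n + 1), by simp; omega, fun r hr => hmem r (List.mem_of_mem_take hr),
      isRegular_take hreg _⟩
  · rintro ⟨rs, rfl, hmem, hreg⟩
    exact le_iSup_of_le rs (le_iSup_of_le hreg (le_iSup_of_le hmem le_rfl))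

/-- Restriction of scalars along a ring homomorphism does not change regularity of a sequence. -/
theorem isRegular_map_algebraMap_iff {A B M : Type*} [CommRing A] [CommRing B] [Algebra A B]
    [AddCommGroup M] [Module A M] [Module B M] [IsScalarTower A B M] (rs : List A) :
    IsRegular M (rs.map (algebraMap A B)) ↔ IsRegular M rs :=
  (AddEquiv.refl M).isRegular_congr <| List.forall₂_map_left_iff.mpr <|
    List.forall₂_same.mpr fun r _ => algebraMap_smul B r

theorem mem_map_list_of_surjective {A B : Type*} [CommRing A] [CommRing B] {f : A →+* B}
    (hf : Function.Surjective f) {a : Ideal A} (rs : List B) (h : ∀ r ∈ rs, r ∈ a.map f) :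
    ∃ ss : List A, (∀ s ∈ ss, s ∈ a) ∧ ss.map f = rs := by
  induction rs with
  | nil => exact ⟨[], by simp, rfl⟩
  | cons r rs ih =>
    obtain ⟨ss, h1, rfl⟩ := ih fun x hx => h x (List.mem_cons_of_mem _ hx)
    obtain ⟨s, hs, rfl⟩ := (Ideal.mem_map_iff_of_surjective f hf).mp (h r List.mem_cons_self)
    exact ⟨s :: ss, by simpa using ⟨hs, h1⟩, rfl⟩

/-- The grade does not change under restriction of scalars along a surjection. -/
theorem grade_map_algebraMap {A B M : Type*} [CommRing A] [CommRing B] [Algebra A B]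
    [AddCommGroup M] [Module A M] [Module B M] [IsScalarTower A B M] [Nontrivial M]
    (h : Function.Surjective (algebraMap A B)) (a : Ideal A) :
    grade (a.map (algebraMap A B)) M = grade a M := by
  refine ENat.eq_of_forall_natCast_le_iff fun n => ?_
  rw [natCast_le_grade_iff, natCast_le_grade_iff]
  constructor
  · rintro ⟨rs, hlen, hmem, hreg⟩
    obtain ⟨ss, h1, rfl⟩ := mem_map_list_of_surjective h rs hmem
    exact ⟨ss, by simpa using hlen, h1, (isRegular_map_algebraMap_iff ss).mp hreg⟩
  · rintro ⟨rs, hlen, hmem, hreg⟩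
    refine ⟨rs.map (algebraMap A B), by simpa using hlen, ?_,
      (isRegular_map_algebraMap_iff rs).mpr hreg⟩
    intro r hr
    obtain ⟨s, hs, rfl⟩ := List.mem_map.mp hr
    exact Ideal.mem_map_of_mem _ (hmem s hs)

end Grade

section Local

variable {A : Type u} [CommRing A] [IsNoetherianRing A] [IsLocalRing A]

/-- Rees's theorem; Nakayama supplies its condition `𝔪M ≠ M`. -/
theorem natCast_le_grade_iff_ext (M : Type u) [AddCommGroup M] [Module A M] [Module.Finite A M]
    [Nontrivial M] (n : ℕ) :
    (n : ℕ∞) ≤ grade (maximalIdeal A) M ↔ ∀ i < n,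
      Subsingleton (Ext (ModuleCat.of A (Shrink.{u} (A ⧸ maximalIdeal A))) (ModuleCat.of A M) i) := by
  rw [natCast_le_grade_iff]
  exact ((ModuleCat.exists_isRegular_tfae (maximalIdeal A) n (ModuleCat.of A M)
    (Submodule.top_ne_ideal_smul_of_le_jacobson_annihilator
      (maximalIdeal_le_jacobson _)).symm.lt_top).out 1 3).symm

variable {L M N : Type u} [AddCommGroup L] [Module A L] [Module.Finite A L] [Nontrivial L]
  [AddCommGroup M] [Module A M] [Module.Finite A M] [Nontrivial M]
  [AddCommGroup N] [Module A N] [Module.Finite A N] [Nontrivial N]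

/-- The depth lemma in the case where the middle term has larger depth than the right one. -/
theorem grade_eq_add_one_of_shortExact {f : L →ₗ[A] M} {g : M →ₗ[A] N}
    (hf : Function.Injective f) (hfg : Function.Exact f g) (hg : Function.Surjective g) {n : ℕ}
    (hN : grade (maximalIdeal A) N = n) (hM : (n : ℕ∞) < grade (maximalIdeal A) M) :
    grade (maximalIdeal A) L = n + 1 := by
  let S : ShortComplex (ModuleCat.{u} A) :=
    ShortComplex.mk (ModuleCat.ofHom f) (ModuleCat.ofHom g)
      (by rw [← ModuleCat.ofHom_comp, hfg.linearMap_comp_eq_zero]; rfl)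
  have hS : S.ShortExact := ModuleCat.shortComplex_shortExact S hfg hf hg
  have hM1 := (natCast_le_grade_iff_ext M (n + 1)).mp (by
    push_cast; exact Order.add_one_le_of_lt hM)
  have hN1 := (natCast_le_grade_iff_ext N n).mp hN.ge
  apply le_antisymm
  · by_contra! h
    have hL := (natCast_le_grade_iff_ext L (n + 2)).mp (by
      push_cast
      have := Order.add_one_le_of_lt h
      rwa [add_assoc, one_add_one_eq_two] at this)
    -- For `i ≤ n`, `Ext^i(k, N)` lies between the vanishing groups `Ext^i(k, M)` and `Ext^(i+1)(k,
    -- L)`.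
    have : ((n + 1 : ℕ) : ℕ∞) ≤ grade (maximalIdeal A) N := by
      refine (natCast_le_grade_iff_ext N (n + 1)).mpr fun i hi => ?_
      have zero1 := AddCommGrpCat.isZero_of_iff_subsingleton.mpr (hM1 i hi)
      have zero2 := AddCommGrpCat.isZero_of_iff_subsingleton.mpr (hL (i + 1) (by omega))
      exact AddCommGrpCat.subsingleton_of_isZero <| ShortComplex.Exact.isZero_of_both_zeros
        (Ext.covariant_sequence_exact₃' _ hS i (i + 1) rfl)
        (zero1.eq_zero_of_src _) (zero2.eq_zero_of_tgt _)
    rw [hN] at this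
    have : n + 1 ≤ n := by exact_mod_cast this
    omega
  · have := (natCast_le_grade_iff_ext L (n + 1)).mpr fun i hi => by
      -- In degree `0` no `Ext` of `N` precedes, so left exactness of Hom is used instead.
      obtain _ | i := i
      · have := hM1 0 hi
        exact (Ext.postcomp_mk₀_injective_of_mono _ S.f (hf := hS.mono_f)).subsingleton
      have zero1 := AddCommGrpCat.isZero_of_iff_subsingleton.mpr (hN1 i (by omega))
      have zero2 := AddCommGrpCat.isZero_of_iff_subsingleton.mpr (hM1 (i + 1) hi)
      exact AddCommGrpCat.subsingleton_of_isZero <| ShortComplex.Exact.isZero_of_both_zeros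
        (Ext.covariant_sequence_exact₁' _ hS i (i + 1) rfl)
        (zero1.eq_zero_of_src _) (zero2.eq_zero_of_tgt _)
    exact_mod_cast this

end Local

section Duplication

variable {R : Type u} [CommRing R]

/-- The diagonal embedding `R → R ⋈ I`. -/
def diagonal (I : Ideal R) : R →+* duplication I :=
  ((RingHom.id R).prod (RingHom.id R)).codRestrict (duplication I)
    fun r => ⟨r, 0, I.zero_mem, by ext <;> simp⟩

theorem mem_duplication_iff (I : Ideal R) (p : R × R) :
    p ∈ duplication I ↔ p.2 - p.1 ∈ I := by
  constructor
  · rintro ⟨r, i, hi, rfl⟩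
    simpa using hi
  · intro h
    exact ⟨p.1, _, h, by ext <;> simp⟩

theorem toBase_surjective (I : Ideal R) : Function.Surjective (toBase I) :=
  fun r => ⟨diagonal I r, rfl⟩

theorem toQuotient_surjective (I : Ideal R) : Function.Surjective (toQuotient I) :=
  Ideal.Quotient.mk_surjective.comp (toBase_surjective I)

/-- The `R`-algebra structure of `R ⋈ I` given by the diagonal embedding. -/
abbrev algebraDiagonal (I : Ideal R) : Algebra R (duplication I) := (diagonal I).toAlgebra

attribute [local instance] algebraDiagonal

theorem isScalarTower_diagonal (I : Ideal R) : IsScalarTower R (duplication I) (R × R) :=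
  .of_algebraMap_smul fun _ _ => rfl

theorem finite_prod (I : Ideal R) : Module.Finite (duplication I) (R × R) :=
  haveI := isScalarTower_diagonal I
  .of_restrictScalars_finite R _ _

theorem finite_duplication [IsNoetherianRing R] (I : Ideal R) :
    Module.Finite R (duplication I) :=
  haveI := isScalarTower_diagonal I
  .of_injective ((Algebra.linearMap (duplication I) (R × R)).restrictScalars R)
    Subtype.val_injective

theorem isNoetherianRing_duplication [IsNoetherianRing R] (I : Ideal R) :
    IsNoetherianRing (duplication I) :=
  haveI := finite_duplication I
  .of_finite R _

theorem diagonal_mem_maximalIdeal [IsLocalRing R] {I : Ideal R} [IsLocalRing (duplication I)]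
    {r : R} (hr : r ∈ maximalIdeal R) : diagonal I r ∈ maximalIdeal (duplication I) :=
  fun h => hr (h.map (toBase I))

theorem extBase_eq [IsLocalRing R] {I : Ideal R} (hI : I ≠ ⊤) :
    extBase hI = maximalIdeal R := by
  have := isLocalRing_duplication hI
  apply le_antisymm
  · refine Ideal.map_le_iff_le_comap.mpr fun x hx h => hx (isUnit_of_isUnit_toBase hI x h)
  · exact fun r hr => Ideal.mem_map_of_mem (toBase I) (diagonal_mem_maximalIdeal hr)

/-- The map `R × R → R ⧸ I`, `(a, b) ↦ b - a`, with kernel `R ⋈ I`. -/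
def differenceMap (I : Ideal R) :
    letI := (toQuotient I).toAlgebra
    R × R →ₗ[duplication I] R ⧸ I :=
  letI := (toQuotient I).toAlgebra
  { toFun p := Ideal.Quotient.mk I (p.2 - p.1)
    map_add' p q := by
      rw [← map_add]
      congr 1
      simp only [Prod.fst_add, Prod.snd_add]
      ring
    map_smul' := by
      rintro ⟨⟨c, d⟩, hx⟩ ⟨a, b⟩
      have hx := (mem_duplication_iff I _).mp hx
      change Ideal.Quotient.mk I (d * b - c * a) =
        Ideal.Quotient.mk I c * Ideal.Quotient.mk I (b - a)
      rw [← map_mul, Ideal.Quotient.eq]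
      -- The two sides differ by `(d - c) * b`, and `d - c ∈ I`.
      convert I.mul_mem_right b hx using 1
      ring }

/-- `R × R` is flat over `R`, so an `R`-regular sequence, moved along the diagonal, stays weakly
regular on it; Nakayama makes it regular. -/
theorem natCast_le_grade_prod [IsNoetherianRing R] [IsLocalRing R] {I : Ideal R}
    [IsLocalRing (duplication I)] (n : ℕ) (h : (n : ℕ∞) ≤ grade (maximalIdeal R) R) :
    (n : ℕ∞) ≤ grade (maximalIdeal (duplication I)) (R × R) := by
  have := isScalarTower_diagonal I
  have := finite_prod I
  rw [natCast_le_grade_iff] at h ⊢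
  obtain ⟨rs, hlen, hmem, hreg⟩ := h
  have hmem' : ∀ d ∈ rs.map (algebraMap R (duplication I)), d ∈ maximalIdeal (duplication I) := by
    intro d hd
    obtain ⟨r, hr, rfl⟩ := List.mem_map.mp hd
    exact diagonal_mem_maximalIdeal (hmem r hr)
  refine ⟨rs.map (algebraMap R (duplication I)), by simpa using hlen, hmem',
    .of_isWeaklyRegular_of_mem_maximalIdeal _ hmem' ?_⟩
  rw [isWeaklyRegular_map_algebraMap_iff,
    ← (TensorProduct.rid R (R × R)).isWeaklyRegular_congr]
  exact hreg.toIsWeaklyRegular.isWeaklyRegular_lTensor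

theorem depth_duplication_eq_add_one [IsNoetherianRing R] [IsLocalRing R] {I : Ideal R}
    (hI : I ≠ ⊤) [IsLocalRing (duplication I)] {n : ℕ}
    (hn : grade (extQuotient hI) (R ⧸ I) = n) (hlt : (n : ℕ∞) < grade (extBase hI) R) :
    depth (duplication I) = n + 1 := by
  let := (toQuotient I).toAlgebra
  have := isNoetherianRing_duplication I
  have := finite_prod I
  have : Nontrivial (R ⧸ I) := Ideal.Quotient.nontrivial_iff.mpr hI
  have : Module.Finite (duplication I) (R ⧸ I) :=
    .of_surjective (Algebra.linearMap (duplication I) (R ⧸ I)) (toQuotient_surjective I)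
  have hN : grade (maximalIdeal (duplication I)) (R ⧸ I) = n :=
    (grade_map_algebraMap (M := R ⧸ I) (toQuotient_surjective I) _).symm.trans hn
  have hM : (n : ℕ∞) < grade (maximalIdeal (duplication I)) (R × R) := by
    rw [extBase_eq hI] at hlt
    have := natCast_le_grade_prod (I := I) (n + 1) (by push_cast; exact Order.add_one_le_of_lt hlt)
    exact lt_of_lt_of_le (by exact_mod_cast n.lt_succ_self) this
  refine grade_eq_add_one_of_shortExact (f := Algebra.linearMap (duplication I) (R × R))
    (g := differenceMap I) Subtype.val_injective ?_ ?_ hN hM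
  · intro p
    change Ideal.Quotient.mk I (p.2 - p.1) = 0 ↔ _
    rw [Ideal.Quotient.eq_zero_iff_mem, ← mem_duplication_iff]
    exact ⟨fun h => ⟨⟨p, h⟩, rfl⟩, fun ⟨x, hx⟩ => hx ▸ x.2⟩
  · intro x
    obtain ⟨r, rfl⟩ := Ideal.Quotient.mk_surjective x
    exact ⟨(0, r), congrArg _ (sub_zero r)⟩

theorem one_le_grade_of_one_le_depth_duplication [IsNoetherianRing R] [IsLocalRing R]
    {I : Ideal R} (hI : I ≠ ⊤) [IsLocalRing (duplication I)]
    (h : 1 ≤ depth (duplication I)) : 1 ≤ grade (maximalIdeal R) R := by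
  obtain ⟨ds, hlen, hmem, hreg⟩ := (natCast_le_grade_iff _ 1).mp (by exact_mod_cast h)
  obtain ⟨d, rfl⟩ := List.length_eq_one_iff.mp hlen
  have hd : IsSMulRegular (duplication I) d := ((isRegular_cons_iff _ _ _).mp hreg).1
  have hdm : d ∈ maximalIdeal (duplication I) := hmem d (by simp)
  -- Both coordinates of `d` lie in `𝔪_R`, so `d` kills `(x, x)` when `𝔪_R` kills `x`.
  have key : ∀ x : R, (∀ r ∈ maximalIdeal R, r * x = 0) → x = 0 := by
    intro x hx
    have hd1 : d.1.1 ∈ maximalIdeal R := fun hu => hdm (isUnit_of_isUnit_toBase hI d hu)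
    have hd2 : d.1.2 ∈ maximalIdeal R := by
      have := Ideal.add_mem _ hd1 (le_maximalIdeal hI ((mem_duplication_iff I _).mp d.2))
      simpa using this
    have h0 : d • diagonal I x = 0 :=
      Subtype.ext (Prod.ext (hx _ hd1) (hx _ hd2))
    have := hd.right_eq_zero_of_smul h0
    exact congrArg (fun y => y.1.1) this
  have hsub : Subsingleton ((R ⧸ maximalIdeal R) →ₗ[R] R) := by
    refine subsingleton_of_forall_eq 0 fun f => ?_
    apply Submodule.linearMap_qext
    ext
    refine key _ fun r hr => ?_
    have : r • (Submodule.mkQ (maximalIdeal R) 1) = 0 := by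
      rw [← map_smul, Submodule.mkQ_apply, Submodule.Quotient.mk_eq_zero]
      simpa using hr
    simpa using congrArg f this
  -- Over a Noetherian ring, `Hom(R ⧸ 𝔪_R, R) = 0` yields an `R`-regular element in the annihilator
  -- of `R ⧸ 𝔪_R`.
  obtain ⟨r, hr, hreg⟩ := IsSMulRegular.subsingleton_linearMap_iff.mp hsub
  rw [Ideal.annihilator_quotient] at hr
  have := (natCast_le_grade_iff (M := R) (maximalIdeal R) 1).mpr ⟨[r], rfl, by simpa using hr,
    .of_isWeaklyRegular_of_mem_maximalIdeal _ (by simpa using hr)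
      ((isWeaklyRegular_singleton_iff R r).mpr hreg)⟩
  exact_mod_cast this

theorem grade_eq_zero_of_isArtinianRing {A : Type*} [CommRing A] [IsArtinianRing A]
    (a : Ideal A) : grade a A = 0 := by
  simp only [grade, ENat.iSup_eq_zero]
  intro rs hreg _
  rw [eq_nil_of_isRegular_on_artinian hreg]
  rfl

end Duplication

end AmalgamatedDuplication

theorem mainTheorem10 {R : Type*} [CommRing R] [IsNoetherianRing R] [IsLocalRing R]
    (I : Ideal R) (hI : I ≠ ⊤) :
    haveI : IsLocalRing (AmalgamatedDuplication.duplication I) :=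
      AmalgamatedDuplication.isLocalRing_duplication hI
    (∀ n : ℕ,
      AmalgamatedDuplication.grade (AmalgamatedDuplication.extQuotient hI) (R ⧸ I) = n →
      (n : ℕ∞) < AmalgamatedDuplication.grade (AmalgamatedDuplication.extBase hI) R →
      AmalgamatedDuplication.depth (AmalgamatedDuplication.duplication I) = n + 1) ∧
    (ringKrullDim (R ⧸ I) = 0 →
      AmalgamatedDuplication.idealTorsion (AmalgamatedDuplication.extBase hI) R ≤ I →
      AmalgamatedDuplication.depth (AmalgamatedDuplication.duplication I) =
        min (AmalgamatedDuplication.grade (AmalgamatedDuplication.extBase hI) R) 1 ∧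
      AmalgamatedDuplication.depth (AmalgamatedDuplication.duplication I) ≤ 1) := by
  have := AmalgamatedDuplication.isLocalRing_duplication hI
  refine ⟨fun n hn hlt => AmalgamatedDuplication.depth_duplication_eq_add_one hI hn hlt,
    fun hdim _ => ?_⟩
  suffices h : AmalgamatedDuplication.depth (AmalgamatedDuplication.duplication I) =
      min (AmalgamatedDuplication.grade (AmalgamatedDuplication.extBase hI) R) 1 from
    ⟨h, h.trans_le (min_le_right _ _)⟩
  by_cases h0 : 1 ≤ AmalgamatedDuplication.grade (AmalgamatedDuplication.extBase hI) R
  · have : Ring.KrullDimLE 0 (R ⧸ I) := Ring.krullDimLE_iff.mpr hdim.le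
    have : IsArtinianRing (R ⧸ I) := IsNoetherianRing.isArtinianRing_of_krullDimLE_zero
    rw [min_eq_right h0]
    simpa using AmalgamatedDuplication.depth_duplication_eq_add_one hI (n := 0)
      (AmalgamatedDuplication.grade_eq_zero_of_isArtinianRing _)
      (lt_of_lt_of_le (by simp) h0)
  · have hd : ¬ 1 ≤ AmalgamatedDuplication.depth (AmalgamatedDuplication.duplication I) :=
      fun h => h0 (by
        rw [AmalgamatedDuplication.extBase_eq hI]
        exact AmalgamatedDuplication.one_le_grade_of_one_le_depth_duplication hI h)
    rw [min_eq_left (not_le.mp h0).le, Order.lt_one_iff.mp (not_le.mp hd),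
      Order.lt_one_iff.mp (not_le.mp h0)]
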